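/- **Convergence of C-SALSA-2.** Let $\mathbb{K}$ be $\mathbb{R}$ or $\mathbb{C}$, let $P\in\mathbb{K}^{p\times n}$ satisfy $P^HP=I$ (the analysis operator of a Parseval frame), let $B\in\mathbb{K}^{m\times n}$, $y\in\mathbb{K}^m$, $\varepsilon\in\mathbb{R}$, and let $\varphi:\mathbb{K}^p\to[-\infty,+\infty]$ be closed (lower semicontinuous), proper and convex. Let $\iota$ be the indicator function of the closed Euclidean ball $\{s\in\mathbb{K}^m:\|s-y\|_2\le\varepsilon\}$ ($0$ on the ball, $+\infty$ off it). Consider the problem $$\min_{x\in\mathbb{K}^n}\ \varphi(Px)\quad\text{subject to}\quad \|Bx-y\|_2\le\varepsilon, \qquad(*)$$ where a solution of $(*)$ is a feasible minimizer with finite objective value. Assume that $(*)$ has a solution $x^*$ which admits a Lagrange multiplier (i.e. belongs to a Kuhn–Tucker pair): there are $\lambda_1\in\partial\varphi(Px^*)$ and $\lambda_2\in\partial\iota(Bx^*)$ with $P^H\lambda_1+B^H\lambda_2=0$, subgradients being taken for the real inner product $\operatorname{Re}\langle\cdot,\cdot\rangle$. For $\tau>0$ and a function $f$ write $\Psi_{\tau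 f}(s)=\arg\min_x \tfrac12\|x-s\|_2^2+\tau f(x)$. Given $\mu>0$ and arbitrary $v_0^{(1)},d_0^{(1)}\in\mathbb{K}^p$, $v_0^{(2)},d_0^{(2)}\in\mathbb{K}^m$, the C-SALSA-2 iteration is, for $k=0,1,2,\dots$, $$\begin{aligned} r_k&=P^H\bigl(v_k^{(1)}+d_k^{(1)}\bigr)+B^H\bigl(v_k^{(2)}+d_k^{(2)}\bigr), & u_{k+1}&=\bigl(P^HP+B^HB\bigr)^{-1}r_k,\\ v_{k+1}^{(1)}&=\Psi_{\varphi/\mu}\bigl(Pu_{k+1}-d_k^{(1)}\bigr), & v_{k+1}^{(2)}&=\Psi_{\iota}\bigl(Bu_{k+1}-d_k^{(2)}\bigr),\\ d_{k+1}^{(1)}&=d_k^{(1)}-Pu_{k+1}+v_{k+1}^{(1)}, & d_{k+1}^{(2)}&=d_k^{(2)}-Bu_{k+1}+v_{k+1}^{(2)}. \end{aligned}$$ Then the stacked matrix $G=\begin{bmatrix}P\\B\end{bmatrix}$ has full column rank $n$, and for every $\mu>0$: from every choice of starting vectors the iteration can be carried out for all $k$, and for every sequence of iterates so produced, $u_k$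 converges to a solution of $(*)$. -/

import Mathlib

open Filter Topology
open scoped Matrix

namespace CSalsa

/-- `φ` is proper: it never takes the value `-∞`, and it is not identically `+∞`. -/
def IsProper {E : Type*} (φ : E → EReal) : Prop :=
  (∀ x, φ x ≠ ⊥) ∧ ∃ x, φ x ≠ ⊤

/-- An extended-real-valued function is convex when its epigraph is a convex set. -/
def IsConvex {E : Type*} [AddCommMonoid E] [Module ℝ E] (φ : E → EReal) : Prop :=
  Convex ℝ {z : E × ℝ | φ z.1 ≤ (z.2 : EReal)}

/-- Closed, proper, convex (closed meaning lower semicontinuous). -/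
structure IsClosedProperConvex {E : Type*} [TopologicalSpace E] [AddCommMonoid E] [Module ℝ E]
    (φ : E → EReal) : Prop where
  closed : LowerSemicontinuous φ
  proper : IsProper φ
  convex : IsConvex φ

open Classical in
/-- The indicator function of a set: `0` on `S` and `+∞` off `S`. -/
noncomputable def indicatorFn {E : Type*} (S : Set E) (s : E) : EReal :=
  if s ∈ S then 0 else ⊤

/-- `v` is a minimizer of `x ↦ (1/2) ‖x - s‖² + τ φ(x)`, i.e. `v = Ψ_{τφ}(s)`, the value at `s` of
the Moreau proximal mapping of `τ φ`. -/
def IsMoreauProx {E : Type*} [NormedAddCommGroup E] (τ : ℝ) (φ : E → EReal) (s v : E) : Prop :=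
  ∀ x : E, ((1 / 2 * ‖v - s‖ ^ 2 : ℝ) : EReal) + (τ : EReal) * φ v ≤
    ((1 / 2 * ‖x - s‖ ^ 2 : ℝ) : EReal) + (τ : EReal) * φ x

section

variable {𝕜 : Type*} [RCLike 𝕜] {n p m : ℕ}

/-- The matrix-vector product `A x`, for vectors with the Euclidean norm. -/
noncomputable def act {a b : ℕ} (A : Matrix (Fin a) (Fin b) 𝕜) (x : EuclideanSpace 𝕜 (Fin b)) :
    EuclideanSpace 𝕜 (Fin a) :=
  WithLp.toLp 2 (A *ᵥ x.ofLp)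

/-- `x` solves `min φ(P x)` subject to `‖B x - y‖₂ ≤ ε` (with finite optimal value). -/
structure IsSolution (φ : EuclideanSpace 𝕜 (Fin p) → EReal)
    (P : Matrix (Fin p) (Fin n) 𝕜) (B : Matrix (Fin m) (Fin n) 𝕜)
    (y : EuclideanSpace 𝕜 (Fin m)) (ε : ℝ) (x : EuclideanSpace 𝕜 (Fin n)) : Prop where
  feasible : ‖act B x - y‖ ≤ ε
  finite : φ (act P x) ≠ ⊤
  le : ∀ x' : EuclideanSpace 𝕜 (Fin n), ‖act B x' - y‖ ≤ ε → φ (act P x) ≤ φ (act P x')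

/-- `g` is a subgradient of `φ` at `z`, for the real inner product `Re ⟪·, ·⟫`. -/
def IsSubgradient {a : ℕ} (φ : EuclideanSpace 𝕜 (Fin a) → EReal)
    (z g : EuclideanSpace 𝕜 (Fin a)) : Prop :=
  φ z ≠ ⊤ ∧ ∀ w, φ z + ((RCLike.re (inner 𝕜 g (w - z)) : ℝ) : EReal) ≤ φ w

/-- `(x, (lam₁, lam₂))` is a Kuhn-Tucker pair of `min φ(P x) + ι(B x)`, where `ι` is the indicator
function of the closed ball of radius `ε` about `y`: the pair `(lam₁, lam₂)` is a Lagrange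
multiplier for the splitting constraints `v₁ = P x`, `v₂ = B x`. -/
structure IsKuhnTuckerPair (φ : EuclideanSpace 𝕜 (Fin p) → EReal)
    (P : Matrix (Fin p) (Fin n) 𝕜) (B : Matrix (Fin m) (Fin n) 𝕜)
    (y : EuclideanSpace 𝕜 (Fin m)) (ε : ℝ) (x : EuclideanSpace 𝕜 (Fin n))
    (lam₁ : EuclideanSpace 𝕜 (Fin p)) (lam₂ : EuclideanSpace 𝕜 (Fin m)) : Prop where
  subgradient₁ : IsSubgradient φ (act P x) lam₁
  subgradient₂ : IsSubgradient (indicatorFn (Metric.closedBall y ε)) (act B x) lam₂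
  stationary : act Pᴴ lam₁ + act Bᴴ lam₂ = 0

/-- The sequences `u, v₁, v₂, d₁, d₂` are produced by the C-SALSA-2 iteration with penalty
parameter `μ`. The starting values are `v₁ 0, v₂ 0, d₁ 0, d₂ 0`; `u 0` is not used. -/
structure IsCSalsa2 (φ : EuclideanSpace 𝕜 (Fin p) → EReal)
    (P : Matrix (Fin p) (Fin n) 𝕜) (B : Matrix (Fin m) (Fin n) 𝕜)
    (y : EuclideanSpace 𝕜 (Fin m)) (ε μ : ℝ)
    (u : ℕ → EuclideanSpace 𝕜 (Fin n))
    (v₁ : ℕ → EuclideanSpace 𝕜 (Fin p)) (v₂ : ℕ → EuclideanSpace 𝕜 (Fin m))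
    (d₁ : ℕ → EuclideanSpace 𝕜 (Fin p)) (d₂ : ℕ → EuclideanSpace 𝕜 (Fin m)) : Prop where
  u_step : ∀ k, u (k + 1) =
    act (Pᴴ * P + Bᴴ * B)⁻¹ (act Pᴴ (v₁ k + d₁ k) + act Bᴴ (v₂ k + d₂ k))
  v₁_step : ∀ k, IsMoreauProx (1 / μ) φ (act P (u (k + 1)) - d₁ k) (v₁ (k + 1))
  v₂_step : ∀ k, IsMoreauProx 1 (indicatorFn (Metric.closedBall y ε))
    (act B (u (k + 1)) - d₂ k) (v₂ (k + 1))
  d₁_step : ∀ k, d₁ (k + 1) = d₁ k - act P (u (k + 1)) + v₁ (k + 1)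
  d₂_step : ∀ k, d₂ (k + 1) = d₂ k - act B (u (k + 1)) + v₂ (k + 1)

end

end CSalsa

/-! ### Douglas–Rachford iteration for a subspace -/

namespace CSalsa

/-! C-SALSA-2 is Douglas–Rachford splitting in disguise. Let `S` be the range of `x ↦ (P x, B x)`,
let `J` be the product of the two proximal maps, and put `t = v - d`. Then `v = J t`, the `u`-step
projects `v + d = 2 J t - t` onto `S`, and the `d`-step gives the next `t`. The `T` with `J T ∈ S`
and `J T - T ∈ Sᗮ` encode Kuhn–Tucker pairs: `J T` is the image of the primal point and `μ (T - J
T)` is the multiplier.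

Since `J` is firmly nonexpansive (`IsMoreauProx.firmlyNonexpansive`), the distance from `t k` to
every such `T` decreases; compactness gives a cluster point, which is again such a `T`, so the whole
sequence converges (`exists_tendsto_of_firmlyNonexpansive`). As `Pᴴ` inverts `P` on the left, `u`
converges too, and `IsKuhnTuckerPair.isSolution` shows that its limit is optimal. -/

/-- Convergence of the Douglas-Rachford iteration for a subspace `S` and a firmly nonexpansive map
`J`, where `g k` is the orthogonal projection of `2 J (t k) - t k` onto `S`. -/
theorem exists_tendsto_of_firmlyNonexpansive {𝕜 V : Type*} [RCLike 𝕜] [NormedAddCommGroup V]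
    [InnerProductSpace 𝕜 V] [FiniteDimensional 𝕜 V] (S : Submodule 𝕜 V) (J : V → V)
    (hJ : ∀ x y, ‖J x - J y‖ ^ 2 ≤ RCLike.re (inner 𝕜 (J x - J y) (x - y)))
    (hfix : ∃ T, J T ∈ S ∧ J T - T ∈ Sᗮ) (t g : ℕ → V)
    (ht : ∀ k, t (k + 1) = g k + t k - J (t k)) (hg : ∀ k, g k ∈ S)
    (horth : ∀ k, J (t k) + J (t k) - t k - g k ∈ Sᗮ) :
    ∃ T, J T ∈ S ∧ J T - T ∈ Sᗮ ∧ Tendsto g atTop (𝓝 (J T)) := by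
  have : ProperSpace V := FiniteDimensional.proper_rclike 𝕜 V
  have hlip : LipschitzWith 1 J := by
    refine LipschitzWith.of_dist_le_mul fun x y ↦ ?_
    rw [dist_eq_norm, dist_eq_norm, NNReal.coe_one, one_mul]
    have h1 := hJ x y
    have h2 := re_inner_le_norm (𝕜 := 𝕜) (J x - J y) (x - y)
    by_contra! h
    nlinarith [norm_nonneg (x - y)]
  have hdecr : ∀ T, J T ∈ S → J T - T ∈ Sᗮ → ∀ k,
      ‖g k - J (t k)‖ ^ 2 + ‖t (k + 1) - T‖ ^ 2 ≤ ‖t k - T‖ ^ 2 := by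
    intro T hT hT' k
    have h1 := hJ (t k) T
    -- With `a`, `b`, `c` the differences of `J (t k)`, `t k`, `g k` from `J T`, `T`, `J T`, this
    -- reads `⟪c, 2a - b - c⟫ = 0`; together with `‖a‖² ≤ re ⟪a, b⟫` it gives the decrease.
    have h2 := S.inner_right_of_mem_orthogonal (S.sub_mem (hg k) hT)
      (Sᗮ.sub_mem (horth k) hT')
    have e1 : J (t k) + J (t k) - t k - g k - (J T - T)
        = (J (t k) - J T) + (J (t k) - J T) - (t k - T) - (g k - J T) := by abel
    rw [e1] at h2
    have e2 : t (k + 1) - T = (g k - J T) - (J (t k) - J T) + (t k - T) := by rw [ht]; abel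
    have e3 : g k - J (t k) = (g k - J T) - (J (t k) - J T) := by abel
    rw [e2, e3]
    generalize g k - J T = c at *
    generalize J (t k) - J T = a at *
    generalize t k - T = b at *
    have h2' := congrArg RCLike.re h2
    simp only [inner_sub_right, inner_add_right, map_sub, map_add, map_zero] at h2'
    rw [norm_add_sq (𝕜 := 𝕜) (c - a) b, norm_sub_sq (𝕜 := 𝕜) c a]
    simp only [inner_sub_left, map_sub]
    rw [inner_self_eq_norm_sq] at h2'
    linarith
  obtain ⟨T₀, hT₀, hT₀'⟩ := hfix
  have hanti : ∀ T, J T ∈ S → J T - T ∈ Sᗮ → Antitone fun k ↦ ‖t k - T‖ ^ 2 := fun T h h' ↦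
    antitone_nat_of_succ_le fun k ↦ by nlinarith [hdecr T h h' k, sq_nonneg ‖g k - J (t k)‖]
  have hlim : ∀ T, J T ∈ S → J T - T ∈ Sᗮ → Tendsto (fun k ↦ ‖t k - T‖ ^ 2) atTop
      (𝓝 (⨅ k, ‖t k - T‖ ^ 2)) := fun T h h' ↦
    tendsto_atTop_ciInf (hanti T h h') ⟨0, by rintro _ ⟨k, rfl⟩; positivity⟩
  have hres : Tendsto (fun k ↦ g k - J (t k)) atTop (𝓝 0) := by
    have h1 := hlim T₀ hT₀ hT₀'
    have h2 := h1.sub ((tendsto_add_atTop_iff_nat 1).2 h1)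
    rw [sub_self] at h2
    have h3 : Tendsto (fun k ↦ ‖g k - J (t k)‖ ^ 2) atTop (𝓝 0) :=
      squeeze_zero (fun _ ↦ sq_nonneg _) (fun k ↦ by linarith [hdecr T₀ hT₀ hT₀' k]) h2
    have h4 := h3.sqrt
    simp only [Real.sqrt_zero, Real.sqrt_sq (norm_nonneg _)] at h4
    exact tendsto_zero_iff_norm_tendsto_zero.2 h4
  obtain ⟨T, -, ψ, hψ, hψT⟩ := tendsto_subseq_of_bounded
    (Metric.isBounded_closedBall (x := T₀) (r := ‖t 0 - T₀‖)) (x := t) (fun k ↦ by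
      rw [mem_closedBall_iff_norm]
      exact (pow_le_pow_iff_left₀ (norm_nonneg _) (norm_nonneg _) two_ne_zero).1
        (hanti T₀ hT₀ hT₀' (Nat.zero_le k)))
  have hJψ : Tendsto (fun k ↦ J (t (ψ k))) atTop (𝓝 (J T)) :=
    (hlip.continuous.tendsto T).comp hψT
  have hgψ : Tendsto (fun k ↦ g (ψ k)) atTop (𝓝 (J T)) := by
    simpa using (hres.comp hψ.tendsto_atTop).add hJψ
  have hTS : J T ∈ S := S.closed_of_finiteDimensional.mem_of_tendsto hgψ
    (Eventually.of_forall fun k ↦ hg _)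
  have hTS' : J T - T ∈ Sᗮ := by
    have h := Sᗮ.closed_of_finiteDimensional.mem_of_tendsto
      (((hJψ.add hJψ).sub hψT).sub hgψ) (Eventually.of_forall fun k ↦ horth _)
    have e : J T + J T - T - J T = J T - T := by abel
    rwa [e] at h
  -- The distances to the cluster point `T` itself converge, and along `ψ` they tend to zero.
  have h0 : Tendsto (fun k ↦ ‖t k - T‖ ^ 2) atTop (𝓝 0) := by
    have h1 := (hlim T hTS hTS').comp hψ.tendsto_atTop
    have h2 : Tendsto (fun k ↦ ‖t (ψ k) - T‖ ^ 2) atTop (𝓝 0) := by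
      simpa using ((hψT.sub_const T).norm.pow 2)
    rw [← tendsto_nhds_unique h1 h2]
    exact hlim T hTS hTS'
  have htT : Tendsto t atTop (𝓝 T) := by
    have h4 := h0.sqrt
    simp only [Real.sqrt_zero, Real.sqrt_sq (norm_nonneg _)] at h4
    exact tendsto_iff_norm_sub_tendsto_zero.2 h4
  refine ⟨T, hTS, hTS', ?_⟩
  simpa using hres.add ((hlip.continuous.tendsto T).comp htT)

/-! ### Subgradients and proximal maps -/

section Prox

variable {𝕜 : Type*} [RCLike 𝕜] {a : ℕ} {φ : EuclideanSpace 𝕜 (Fin a) → EReal} {τ : ℝ}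

/-- Expand `‖x - s‖²` about `z` and add `τ` times the subgradient inequality. When the linear term
vanishes, `z` is the minimizer; in general the quadratic term gives coercivity. -/
theorem IsSubgradient.prox_objective_le {z g : EuclideanSpace 𝕜 (Fin a)}
    (hg : IsSubgradient φ z g) (hφ : IsProper φ) (hτ : 0 < τ) (s x : EuclideanSpace 𝕜 (Fin a)) :
    ((1 / 2 * ‖z - s‖ ^ 2 : ℝ) : EReal) + (τ : EReal) * φ z +
      ((1 / 2 * ‖x - z‖ ^ 2 + RCLike.re (inner 𝕜 (z - s + (τ : 𝕜) • g) (x - z)) : ℝ) : EReal) ≤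
    ((1 / 2 * ‖x - s‖ ^ 2 : ℝ) : EReal) + (τ : EReal) * φ x := by
  obtain ⟨hz, hsub⟩ := hg
  have hx := hsub x
  have hxb := hφ.1 x
  lift φ z to ℝ using ⟨hz, hφ.1 z⟩ with c
  rcases eq_or_ne (φ x) ⊤ with hxt | hxt
  · rw [hxt, EReal.coe_mul_top_of_pos hτ, EReal.coe_add_top]
    exact le_top
  lift φ x to ℝ using ⟨hxt, hxb⟩ with b
  norm_cast at hx ⊢
  have e : x - s = (z - s) + (x - z) := by abel
  rw [e, norm_add_sq (𝕜 := 𝕜) (z - s) (x - z), inner_add_left, inner_smul_left, map_add,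
    RCLike.conj_ofReal, RCLike.re_ofReal_mul]
  nlinarith

theorem IsSubgradient.isMoreauProx {z g : EuclideanSpace 𝕜 (Fin a)}
    (hg : IsSubgradient φ z g) (hφ : IsProper φ) (hτ : 0 < τ) :
    IsMoreauProx τ φ (z + (τ : 𝕜) • g) z := by
  intro x
  refine le_trans ?_ (hg.prox_objective_le hφ hτ (z + (τ : 𝕜) • g) x)
  have e : z - (z + (τ : 𝕜) • g) + (τ : 𝕜) • g = 0 := by abel
  rw [e, inner_zero_left, map_zero, add_zero]
  refine le_add_of_nonneg_right ?_
  exact_mod_cast (by positivity : (0 : ℝ) ≤ 1 / 2 * ‖x - z‖ ^ 2)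

theorem lowerSemicontinuous_prox_objective (hφ : LowerSemicontinuous φ) (hτ : 0 < τ)
    (s : EuclideanSpace 𝕜 (Fin a)) :
    LowerSemicontinuous fun x ↦ ((1 / 2 * ‖x - s‖ ^ 2 : ℝ) : EReal) + (τ : EReal) * φ x := by
  have h1 : LowerSemicontinuous fun x ↦ ((1 / 2 * ‖x - s‖ ^ 2 : ℝ) : EReal) :=
    (continuous_coe_real_ereal.comp (by fun_prop)).lowerSemicontinuous
  have h2 : LowerSemicontinuous fun x ↦ (τ : EReal) * φ x := by
    refine Continuous.comp_lowerSemicontinuous (g := fun r : EReal ↦ (τ : EReal) * r) ?_ hφ ?_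
    · refine continuous_iff_continuousAt.2 fun r ↦ ?_
      have hτ' : (τ : EReal) ≠ 0 := by exact_mod_cast hτ.ne'
      exact ContinuousAt.comp (f := fun r : EReal ↦ ((τ : EReal), r))
        (EReal.continuousAt_mul (Or.inl hτ') (Or.inl hτ') (Or.inl (EReal.coe_ne_bot _))
          (Or.inl (EReal.coe_ne_top _))) (by fun_prop)
    · exact fun b c h ↦ mul_le_mul_of_nonneg_left h (by exact_mod_cast hτ.le)
  exact h1.add' h2 fun x ↦ EReal.continuousAt_add (Or.inl (EReal.coe_ne_top _))
    (Or.inl (EReal.coe_ne_bot _))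

theorem IsSubgradient.exists_isMoreauProx {z g : EuclideanSpace 𝕜 (Fin a)}
    (hg : IsSubgradient φ z g) (hφ : LowerSemicontinuous φ) (hp : IsProper φ) (hτ : 0 < τ)
    (s : EuclideanSpace 𝕜 (Fin a)) : ∃ v, IsMoreauProx τ φ s v := by
  -- Beyond this radius `1/2 * ‖x - z‖²` dominates the linear term, so the objective is at least its
  -- value at `z`, and minimizing over the compact ball suffices.
  set R : ℝ := 2 * ‖z - s + (τ : 𝕜) • g‖ with hR
  have hzR : z ∈ Metric.closedBall z R := Metric.mem_closedBall_self (by positivity)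
  obtain ⟨v, -, hv⟩ := LowerSemicontinuousOn.exists_isMinOn ⟨z, hzR⟩
    (isCompact_closedBall z R) ((lowerSemicontinuous_prox_objective hφ hτ s).lowerSemicontinuousOn _)
  refine ⟨v, fun x ↦ ?_⟩
  by_cases hx : x ∈ Metric.closedBall z R
  · exact hv hx
  refine (hv hzR).trans (le_trans ?_ (hg.prox_objective_le hp hτ s x))
  refine le_add_of_nonneg_right ?_
  rw [mem_closedBall_iff_norm, not_le] at hx
  have h1 := (abs_le.1 ((RCLike.abs_re_le_norm _).trans
    (norm_inner_le_norm (𝕜 := 𝕜) (z - s + (τ : 𝕜) • g) (x - z)))).1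
  have h2 : (0 : ℝ) ≤ 1 / 2 * ‖x - z‖ ^ 2 +
      RCLike.re (inner 𝕜 (z - s + (τ : 𝕜) • g) (x - z)) := by
    nlinarith [norm_nonneg (x - z)]
  exact_mod_cast h2

theorem IsMoreauProx.ne_top {s v : EuclideanSpace 𝕜 (Fin a)} (hv : IsMoreauProx τ φ s v)
    (hφ : IsProper φ) (hτ : 0 < τ) : φ v ≠ ⊤ := by
  intro h
  obtain ⟨x, hx⟩ := hφ.2
  have h1 := hv x
  rw [h, EReal.coe_mul_top_of_pos hτ, EReal.coe_add_top, top_le_iff] at h1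
  lift φ x to ℝ using ⟨hx, hφ.1 x⟩ with c
  norm_cast at h1
  exact EReal.coe_ne_top _ h1

theorem nonneg_of_forall_add_mul_nonneg {b c : ℝ}
    (h : ∀ t : ℝ, 0 < t → t < 1 → 0 ≤ b + t * c) : 0 ≤ b := by
  have h1 : Tendsto (fun t : ℝ ↦ b + t * c) (𝓝[>] 0) (𝓝 b) := by
    have h2 : Continuous fun t : ℝ ↦ b + t * c := by fun_prop
    simpa using (h2.tendsto 0).mono_left nhdsWithin_le_nhds
  refine ge_of_tendsto h1 ?_
  filter_upwards [Ioo_mem_nhdsGT one_pos] with t ht using h t ht.1 ht.2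

/-- Compare `v` with `(1 - t) • v + t • w`, use convexity, divide by `t` and let `t → 0`. -/
theorem IsMoreauProx.isSubgradient {s v : EuclideanSpace 𝕜 (Fin a)} (hv : IsMoreauProx τ φ s v)
    (hφ : IsProper φ) (hc : IsConvex φ) (hτ : 0 < τ) :
    IsSubgradient φ v (((τ⁻¹ : ℝ) : 𝕜) • (s - v)) := by
  have hvt := hv.ne_top hφ hτ
  refine ⟨hvt, fun w ↦ ?_⟩
  rcases eq_or_ne (φ w) ⊤ with hwt | hwt
  · rw [hwt]; exact le_top
  have hvf : φ v = ((φ v).toReal : EReal) := (EReal.coe_toReal hvt (hφ.1 v)).symm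
  have hwf : φ w = ((φ w).toReal : EReal) := (EReal.coe_toReal hwt (hφ.1 w)).symm
  set f := (φ v).toReal
  set b := (φ w).toReal
  rw [hvf, hwf]
  norm_cast
  rw [inner_smul_left, RCLike.conj_ofReal, RCLike.re_ofReal_mul]
  have key : 0 ≤ RCLike.re (inner 𝕜 (v - s) (w - v)) + τ * (b - f) := by
    refine nonneg_of_forall_add_mul_nonneg (c := 1 / 2 * ‖w - v‖ ^ 2) fun t ht0 ht1 ↦ ?_
    have h1 := hc (x := (v, f)) (y := (w, b)) hvf.le hwf.le
      (sub_nonneg.2 ht1.le) ht0.le (sub_add_cancel 1 t)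
    have h2 : φ ((1 - t) • v + t • w) ≤ (((1 - t) * f + t * b : ℝ) : EReal) := h1
    have h3 := (hv ((1 - t) • v + t • w)).trans
      (add_le_add_right (mul_le_mul_of_nonneg_left h2 (by exact_mod_cast hτ.le)) _)
    rw [hvf] at h3
    norm_cast at h3
    have e : (1 - t) • v + t • w - s = (v - s) + (t : 𝕜) • (w - v) := by
      rw [← RCLike.real_smul_eq_coe_smul (K := 𝕜), sub_smul, smul_sub, one_smul]; abel
    rw [e, norm_add_sq (𝕜 := 𝕜), inner_smul_right, RCLike.re_ofReal_mul, norm_smul,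
      RCLike.norm_ofReal, abs_of_pos ht0] at h3
    refine nonneg_of_mul_nonneg_right (a := t) ?_ ht0
    nlinarith
  have e2 : inner 𝕜 (s - v) (w - v) = - inner 𝕜 (v - s) (w - v) := by
    rw [← inner_neg_left, neg_sub]
  rw [e2, map_neg]
  have h4 : τ⁻¹ * (RCLike.re (inner 𝕜 (v - s) (w - v)) + τ * (b - f))
      = b - f + τ⁻¹ * RCLike.re (inner 𝕜 (v - s) (w - v)) := by
    field_simp; ring
  have h5 := mul_nonneg (inv_nonneg.2 hτ.le) key
  linarith

theorem IsSubgradient.monotone {z w g h : EuclideanSpace 𝕜 (Fin a)} (hφ : IsProper φ)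
    (hg : IsSubgradient φ z g) (hh : IsSubgradient φ w h) :
    0 ≤ RCLike.re (inner 𝕜 (g - h) (z - w)) := by
  have h1 := hg.2 w
  have h2 := hh.2 z
  lift φ z to ℝ using ⟨hg.1, hφ.1 z⟩ with c
  lift φ w to ℝ using ⟨hh.1, hφ.1 w⟩ with b
  norm_cast at h1 h2
  have e : inner 𝕜 (g - h) (z - w) = - inner 𝕜 g (w - z) - inner 𝕜 h (z - w) := by
    rw [← inner_neg_right, neg_sub, inner_sub_left]
  rw [e, map_sub, map_neg]
  linarith

/-- This is monotonicity of the subdifferential, applied to the subgradients `τ⁻¹ • (s - v)` and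
`τ⁻¹ • (s' - v')`. -/
theorem IsMoreauProx.firmlyNonexpansive {s s' v v' : EuclideanSpace 𝕜 (Fin a)}
    (hv : IsMoreauProx τ φ s v) (hv' : IsMoreauProx τ φ s' v')
    (hφ : IsProper φ) (hc : IsConvex φ) (hτ : 0 < τ) :
    ‖v - v'‖ ^ 2 ≤ RCLike.re (inner 𝕜 (v - v') (s - s')) := by
  have h := (hv.isSubgradient hφ hc hτ).monotone hφ (hv'.isSubgradient hφ hc hτ)
  have e : s - v - (s' - v') = (s - s') - (v - v') := by abel
  rw [← smul_sub, inner_smul_left, RCLike.conj_ofReal, RCLike.re_ofReal_mul, e, inner_sub_left,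
    map_sub, inner_self_eq_norm_sq, inner_re_symm] at h
  have h' := nonneg_of_mul_nonneg_right h (inv_pos.2 hτ)
  linarith

theorem IsMoreauProx.unique {s v v' : EuclideanSpace 𝕜 (Fin a)}
    (hv : IsMoreauProx τ φ s v) (hv' : IsMoreauProx τ φ s v')
    (hφ : IsProper φ) (hc : IsConvex φ) (hτ : 0 < τ) : v = v' := by
  have h := hv.firmlyNonexpansive hv' hφ hc hτ
  rw [sub_self, inner_zero_right, map_zero] at h
  exact sub_eq_zero.1 (norm_eq_zero.1 (pow_eq_zero_iff two_ne_zero |>.1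
    (le_antisymm h (sq_nonneg _))))

end Prox

/-! ### Indicator functions -/

section Indicator

theorem coe_mul_indicatorFn {E : Type*} (S : Set E) {τ : ℝ} (hτ : 0 < τ) (s : E) :
    (τ : EReal) * indicatorFn S s = indicatorFn S s := by
  unfold indicatorFn
  split_ifs
  · exact mul_zero _
  · exact EReal.coe_mul_top_of_pos hτ

/-- Allows both blocks to use the parameter `1 / μ`, so that both multipliers are scaled alike and
stationarity survives. -/
theorem isMoreauProx_indicatorFn_iff {E : Type*} [NormedAddCommGroup E] (S : Set E) {τ : ℝ}
    (hτ : 0 < τ) (s v : E) :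
    IsMoreauProx 1 (indicatorFn S) s v ↔ IsMoreauProx τ (indicatorFn S) s v := by
  simp only [IsMoreauProx, coe_mul_indicatorFn S hτ, coe_mul_indicatorFn S one_pos]

theorem isClosedProperConvex_indicatorFn {E : Type*} [TopologicalSpace E] [AddCommMonoid E]
    [Module ℝ E] {S : Set E} (hS : IsClosed S) (hc : Convex ℝ S) (hne : S.Nonempty) :
    IsClosedProperConvex (indicatorFn S) where
  closed := by
    rw [lowerSemicontinuous_iff_isClosed_preimage]
    intro r
    rcases eq_or_ne r ⊤ with rfl | hr
    · simp
    by_cases h0 : 0 ≤ r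
    · convert hS
      ext x
      by_cases hx : x ∈ S <;> simp [indicatorFn, hx, h0, hr]
    · convert isClosed_empty
      ext x
      by_cases hx : x ∈ S <;> simp [indicatorFn, hx, h0, hr]
  proper := by
    obtain ⟨x, hx⟩ := hne
    refine ⟨fun x ↦ ?_, x, by simp [indicatorFn, hx]⟩
    by_cases hx : x ∈ S <;> simp [indicatorFn, hx]
  convex := by
    have e : {z : E × ℝ | indicatorFn S z.1 ≤ (z.2 : EReal)} = S ×ˢ Set.Ici (0 : ℝ) := by
      ext ⟨x, r⟩
      by_cases hx : x ∈ S <;> simp [indicatorFn, hx]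
    rw [IsConvex, e]
    exact hc.prod (convex_Ici 0)

end Indicator

/-! ### Matrix action on Euclidean vectors -/

section Act

variable {𝕜 : Type*} [RCLike 𝕜] {a b c : ℕ}

theorem act_eq_toEuclideanLin (A : Matrix (Fin a) (Fin b) 𝕜) (x : EuclideanSpace 𝕜 (Fin b)) :
    act A x = Matrix.toEuclideanLin A x := rfl

theorem act_add (A : Matrix (Fin a) (Fin b) 𝕜) (x y : EuclideanSpace 𝕜 (Fin b)) :
    act A (x + y) = act A x + act A y := map_add (Matrix.toEuclideanLin A) x y

theorem act_sub (A : Matrix (Fin a) (Fin b) 𝕜) (x y : EuclideanSpace 𝕜 (Fin b)) :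
    act A (x - y) = act A x - act A y := map_sub (Matrix.toEuclideanLin A) x y

theorem act_smul (A : Matrix (Fin a) (Fin b) 𝕜) (r : 𝕜) (x : EuclideanSpace 𝕜 (Fin b)) :
    act A (r • x) = r • act A x := map_smul (Matrix.toEuclideanLin A) r x

theorem continuous_act (A : Matrix (Fin a) (Fin b) 𝕜) : Continuous (act A) :=
  (Matrix.toEuclideanLin A).continuous_of_finiteDimensional

theorem act_act (A : Matrix (Fin a) (Fin b) 𝕜) (C : Matrix (Fin b) (Fin c) 𝕜)
    (x : EuclideanSpace 𝕜 (Fin c)) : act A (act C x) = act (A * C) x := by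
  simp [act, Matrix.mulVec_mulVec]

theorem act_one (x : EuclideanSpace 𝕜 (Fin a)) : act (1 : Matrix (Fin a) (Fin a) 𝕜) x = x := by
  simp [act]

theorem add_act (A C : Matrix (Fin a) (Fin b) 𝕜) (x : EuclideanSpace 𝕜 (Fin b)) :
    act (A + C) x = act A x + act C x := by
  simp [act, Matrix.add_mulVec]

theorem inner_act_left (A : Matrix (Fin a) (Fin b) 𝕜) (x : EuclideanSpace 𝕜 (Fin b))
    (y : EuclideanSpace 𝕜 (Fin a)) : inner 𝕜 (act A x) y = inner 𝕜 x (act Aᴴ y) := by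
  rw [act_eq_toEuclideanLin, act_eq_toEuclideanLin, Matrix.toEuclideanLin_conjTranspose_eq_adjoint,
    LinearMap.adjoint_inner_right]

end Act

/-! ### The stacked operator and its range -/

section Stacked

variable {𝕜 : Type*} [RCLike 𝕜] {n p m : ℕ} {P : Matrix (Fin p) (Fin n) 𝕜}
  {B : Matrix (Fin m) (Fin n) 𝕜}

theorem rank_fromRows_of_conjTranspose_mul_self (hP : Pᴴ * P = 1) :
    (Matrix.fromRows P B).rank = n := by
  refine le_antisymm ((Matrix.rank_le_card_width _).trans (Fintype.card_fin n).le) ?_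
  have h : Matrix.fromCols Pᴴ (0 : Matrix (Fin n) (Fin m) 𝕜) * Matrix.fromRows P B = 1 := by
    rw [Matrix.fromCols_mul_fromRows, hP, Matrix.zero_mul, add_zero]
  have h1 := Matrix.rank_mul_le_right (Matrix.fromCols Pᴴ (0 : Matrix (Fin n) (Fin m) 𝕜))
    (Matrix.fromRows P B)
  rwa [h, Matrix.rank_one, Fintype.card_fin] at h1

open scoped ComplexOrder in
theorem isUnit_gram_add_gram (hP : Pᴴ * P = 1) : IsUnit (Pᴴ * P + Bᴴ * B) := by
  rw [hP]
  exact (Matrix.PosDef.one.add_posSemidef (Matrix.posSemidef_conjTranspose_mul_self B)).isUnit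

/-- The map `x ↦ (P x, B x)` into the Euclidean product. -/
noncomputable def stacked (P : Matrix (Fin p) (Fin n) 𝕜) (B : Matrix (Fin m) (Fin n) 𝕜) :
    EuclideanSpace 𝕜 (Fin n) →ₗ[𝕜]
      WithLp 2 (EuclideanSpace 𝕜 (Fin p) × EuclideanSpace 𝕜 (Fin m)) where
  toFun x := WithLp.toLp 2 (act P x, act B x)
  map_add' x y := by rw [act_add, act_add]; rfl
  map_smul' r x := by rw [act_smul, act_smul]; rfl

/-- The orthogonal complement of a range is the kernel of the adjoint; this turns stationarity of
multipliers into orthogonality to `S`. -/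
theorem mem_orthogonal_range_stacked
    {w : WithLp 2 (EuclideanSpace 𝕜 (Fin p) × EuclideanSpace 𝕜 (Fin m))} :
    w ∈ (LinearMap.range (stacked P B))ᗮ ↔ act Pᴴ w.fst + act Bᴴ w.snd = 0 := by
  have key : ∀ x, inner 𝕜 (stacked P B x) w = inner 𝕜 x (act Pᴴ w.fst + act Bᴴ w.snd) := by
    intro x
    rw [inner_add_right, ← inner_act_left, ← inner_act_left]
    rfl
  rw [Submodule.mem_orthogonal]
  constructor
  · intro h
    rw [← inner_self_eq_zero (𝕜 := 𝕜), ← key]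
    exact h _ ⟨_, rfl⟩
  · rintro h _ ⟨x, rfl⟩
    rw [key, h, inner_zero_right]

theorem normal_equation (hP : Pᴴ * P = 1) {s₁ : EuclideanSpace 𝕜 (Fin p)}
    {s₂ : EuclideanSpace 𝕜 (Fin m)} {x : EuclideanSpace 𝕜 (Fin n)}
    (hx : x = act (Pᴴ * P + Bᴴ * B)⁻¹ (act Pᴴ s₁ + act Bᴴ s₂)) :
    act Pᴴ (s₁ - act P x) + act Bᴴ (s₂ - act B x) = 0 := by
  have hu := (Matrix.isUnit_iff_isUnit_det _).1 (isUnit_gram_add_gram (B := B) hP)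
  have h := congrArg (act (Pᴴ * P + Bᴴ * B)) hx
  rw [act_act, Matrix.mul_nonsing_inv _ hu, act_one, add_act, ← act_act, ← act_act] at h
  rw [act_sub, act_sub, sub_add_sub_comm, h, sub_self]

end Stacked

/-! ### Optimality, existence and convergence of the iterates -/

section Convergence

variable {𝕜 : Type*} [RCLike 𝕜] {n p m : ℕ} {φ : EuclideanSpace 𝕜 (Fin p) → EReal}
  {P : Matrix (Fin p) (Fin n) 𝕜} {B : Matrix (Fin m) (Fin n) 𝕜}
  {y : EuclideanSpace 𝕜 (Fin m)} {ε μ : ℝ}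

theorem indicatorFn_of_mem {E : Type*} {S : Set E} {s : E} (h : s ∈ S) : indicatorFn S s = 0 :=
  if_pos h

theorem mem_of_indicatorFn_ne_top {E : Type*} {S : Set E} {s : E} (h : indicatorFn S s ≠ ⊤) :
    s ∈ S := by
  by_contra hs
  exact h (if_neg hs)

/-- Between feasible points the `lam₂` term is nonpositive; stationarity makes the `lam₁` term its
negative, hence nonnegative. -/
theorem IsKuhnTuckerPair.isSolution {x : EuclideanSpace 𝕜 (Fin n)}
    {lam₁ : EuclideanSpace 𝕜 (Fin p)} {lam₂ : EuclideanSpace 𝕜 (Fin m)}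
    (h : IsKuhnTuckerPair φ P B y ε x lam₁ lam₂) : IsSolution φ P B y ε x := by
  have hx := mem_of_indicatorFn_ne_top h.subgradient₂.1
  refine ⟨mem_closedBall_iff_norm.1 hx, h.subgradient₁.1, fun x' hx' ↦ ?_⟩
  have h2 := h.subgradient₂.2 (act B x')
  rw [indicatorFn_of_mem hx, indicatorFn_of_mem (mem_closedBall_iff_norm.2 hx'), zero_add] at h2
  norm_cast at h2
  refine le_trans (le_add_of_nonneg_right ?_) (h.subgradient₁.2 (act P x'))
  have e : RCLike.re (inner 𝕜 lam₁ (act P x' - act P x)) +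
      RCLike.re (inner 𝕜 lam₂ (act B x' - act B x)) = 0 := by
    rw [inner_re_symm, inner_re_symm lam₂, ← map_add, ← act_sub, ← act_sub, inner_act_left,
      inner_act_left, ← inner_add_right, h.stationary, inner_zero_right, map_zero]
  exact_mod_cast (by linarith :
    (0 : ℝ) ≤ RCLike.re (inner 𝕜 lam₁ (act P x' - act P x)))

theorem exists_isCSalsa2
    (h₁ : ∀ s, ∃ v, IsMoreauProx (1 / μ) φ s v)
    (h₂ : ∀ s, ∃ v, IsMoreauProx 1 (indicatorFn (Metric.closedBall y ε)) s v)
    (a₁ b₁ : EuclideanSpace 𝕜 (Fin p)) (a₂ b₂ : EuclideanSpace 𝕜 (Fin m)) :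
    ∃ u v₁ v₂ d₁ d₂, IsCSalsa2 φ P B y ε μ u v₁ v₂ d₁ d₂ ∧
      v₁ 0 = a₁ ∧ v₂ 0 = a₂ ∧ d₁ 0 = b₁ ∧ d₂ 0 = b₂ := by
  choose J₁ hJ₁ using h₁
  choose J₂ hJ₂ using h₂
  let U (v₁ d₁ : EuclideanSpace 𝕜 (Fin p)) (v₂ d₂ : EuclideanSpace 𝕜 (Fin m)) :
      EuclideanSpace 𝕜 (Fin n) :=
    act (Pᴴ * P + Bᴴ * B)⁻¹ (act Pᴴ (v₁ + d₁) + act Bᴴ (v₂ + d₂))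
  let step (z : EuclideanSpace 𝕜 (Fin n) × (EuclideanSpace 𝕜 (Fin p) × EuclideanSpace 𝕜 (Fin m)) ×
      (EuclideanSpace 𝕜 (Fin p) × EuclideanSpace 𝕜 (Fin m))) :
      EuclideanSpace 𝕜 (Fin n) × (EuclideanSpace 𝕜 (Fin p) × EuclideanSpace 𝕜 (Fin m)) ×
      (EuclideanSpace 𝕜 (Fin p) × EuclideanSpace 𝕜 (Fin m)) :=
    let u := U z.2.1.1 z.2.2.1 z.2.1.2 z.2.2.2
    let v₁ := J₁ (act P u - z.2.2.1)
    let v₂ := J₂ (act B u - z.2.2.2)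
    (u, (v₁, v₂), (z.2.2.1 - act P u + v₁, z.2.2.2 - act B u + v₂))
  let z (k : ℕ) := step^[k] (0, (a₁, a₂), (b₁, b₂))
  have hz : ∀ k, z (k + 1) = step (z k) := fun k ↦ Function.iterate_succ_apply' _ _ _
  refine ⟨fun k ↦ (z k).1, fun k ↦ (z k).2.1.1, fun k ↦ (z k).2.1.2, fun k ↦ (z k).2.2.1,
    fun k ↦ (z k).2.2.2, ⟨fun k ↦ ?_, fun k ↦ ?_, fun k ↦ ?_, fun k ↦ ?_, fun k ↦ ?_⟩,
    rfl, rfl, rfl, rfl⟩ <;> simp only [hz] <;> try rfl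
  · exact hJ₁ _
  · exact hJ₂ _

theorem IsCSalsa2.exists_tendsto_isSolution (hφ : IsClosedProperConvex φ) (hP : Pᴴ * P = 1)
    (hμ : 0 < μ) {x : EuclideanSpace 𝕜 (Fin n)} {lam₁ : EuclideanSpace 𝕜 (Fin p)}
    {lam₂ : EuclideanSpace 𝕜 (Fin m)} (hx : IsKuhnTuckerPair φ P B y ε x lam₁ lam₂)
    {u : ℕ → EuclideanSpace 𝕜 (Fin n)} {v₁ d₁ : ℕ → EuclideanSpace 𝕜 (Fin p)}
    {v₂ d₂ : ℕ → EuclideanSpace 𝕜 (Fin m)} (h : IsCSalsa2 φ P B y ε μ u v₁ v₂ d₁ d₂) :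
    ∃ x, IsSolution φ P B y ε x ∧ Tendsto u atTop (𝓝 x) := by
  have hτ : 0 < 1 / μ := by positivity
  have hι : IsClosedProperConvex (indicatorFn (Metric.closedBall y ε)) :=
    isClosedProperConvex_indicatorFn Metric.isClosed_closedBall (convex_closedBall y ε)
      ⟨_, mem_of_indicatorFn_ne_top hx.subgradient₂.1⟩
  choose J₁ hJ₁ using hx.subgradient₁.exists_isMoreauProx hφ.closed hφ.proper hτ
  choose J₂ hJ₂ using hx.subgradient₂.exists_isMoreauProx hι.closed hι.proper hτ
  let J (w : WithLp 2 (EuclideanSpace 𝕜 (Fin p) × EuclideanSpace 𝕜 (Fin m))) :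
      WithLp 2 (EuclideanSpace 𝕜 (Fin p) × EuclideanSpace 𝕜 (Fin m)) :=
    WithLp.toLp 2 (J₁ w.fst, J₂ w.snd)
  have hJ : ∀ w w', ‖J w - J w'‖ ^ 2 ≤ RCLike.re (inner 𝕜 (J w - J w') (w - w')) := by
    intro w w'
    rw [WithLp.prod_norm_sq_eq_of_L2, WithLp.prod_inner_apply, map_add]
    exact add_le_add
      ((hJ₁ w.fst).firmlyNonexpansive (hJ₁ w'.fst) hφ.proper hφ.convex hτ)
      ((hJ₂ w.snd).firmlyNonexpansive (hJ₂ w'.snd) hι.proper hι.convex hτ)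
  have hJ_eq : ∀ {s₁ v₁ s₂ v₂}, IsMoreauProx (1 / μ) φ s₁ v₁ →
      IsMoreauProx (1 / μ) (indicatorFn (Metric.closedBall y ε)) s₂ v₂ →
      J (WithLp.toLp 2 (s₁, s₂)) = WithLp.toLp 2 (v₁, v₂) := by
    intro s₁ v₁ s₂ v₂ e₁ e₂
    have e₁' := (hJ₁ s₁).unique e₁ hφ.proper hφ.convex hτ
    have e₂' := (hJ₂ s₂).unique e₂ hι.proper hι.convex hτ
    exact congrArg (WithLp.toLp 2) (Prod.ext e₁' e₂')
  -- The index starts at 1: the arbitrary starting vectors `v₁ 0`, `v₂ 0` need not be proximal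
  -- values.
  let t (k : ℕ) : WithLp 2 (EuclideanSpace 𝕜 (Fin p) × EuclideanSpace 𝕜 (Fin m)) :=
    WithLp.toLp 2 (v₁ (k + 1) - d₁ (k + 1), v₂ (k + 1) - d₂ (k + 1))
  have hJt : ∀ k, J (t k) = WithLp.toLp 2 (v₁ (k + 1), v₂ (k + 1)) := by
    intro k
    refine hJ_eq ?_ ?_
    · have e : v₁ (k + 1) - d₁ (k + 1) = act P (u (k + 1)) - d₁ k := by rw [h.d₁_step]; abel
      rw [e]
      exact h.v₁_step k
    · have e : v₂ (k + 1) - d₂ (k + 1) = act B (u (k + 1)) - d₂ k := by rw [h.d₂_step]; abel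
      rw [e]
      exact (isMoreauProx_indicatorFn_iff _ hτ _ _).1 (h.v₂_step k)
  obtain ⟨T, ⟨x', hx'⟩, hT, hlim⟩ : ∃ T, J T ∈ LinearMap.range (stacked P B) ∧
      J T - T ∈ (LinearMap.range (stacked P B))ᗮ ∧
      Tendsto (fun k ↦ stacked P B (u (k + 2))) atTop (𝓝 (J T)) := by
    refine exists_tendsto_of_firmlyNonexpansive _ J hJ ?_ t _ ?_ (fun k ↦ ⟨_, rfl⟩) ?_
    -- The given Kuhn–Tucker pair supplies the required `T`, namely `stacked P B x` plus `1 / μ`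
    -- times the multiplier.
    · have e : J (WithLp.toLp 2 (act P x + ((1 / μ : ℝ) : 𝕜) • lam₁,
          act B x + ((1 / μ : ℝ) : 𝕜) • lam₂)) = stacked P B x :=
        hJ_eq (hx.subgradient₁.isMoreauProx hφ.proper hτ) (hx.subgradient₂.isMoreauProx hι.proper hτ)
      refine ⟨_, ⟨x, e.symm⟩, ?_⟩
      rw [e, mem_orthogonal_range_stacked]
      change act Pᴴ (act P x - (act P x + ((1 / μ : ℝ) : 𝕜) • lam₁)) +
        act Bᴴ (act B x - (act B x + ((1 / μ : ℝ) : 𝕜) • lam₂)) = 0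
      rw [sub_add_cancel_left, sub_add_cancel_left, ← neg_smul, ← neg_smul, act_smul,
        act_smul, ← smul_add, hx.stationary, smul_zero]
    · intro k
      rw [hJt]
      have e₁ : v₁ (k + 2) - d₁ (k + 2) =
          act P (u (k + 2)) + (v₁ (k + 1) - d₁ (k + 1)) - v₁ (k + 1) := by
        rw [h.d₁_step (k + 1)]; abel
      have e₂ : v₂ (k + 2) - d₂ (k + 2) =
          act B (u (k + 2)) + (v₂ (k + 1) - d₂ (k + 1)) - v₂ (k + 1) := by
        rw [h.d₂_step (k + 1)]; abel
      exact congrArg (WithLp.toLp 2) (Prod.ext e₁ e₂)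
    · intro k
      rw [hJt, mem_orthogonal_range_stacked, ← normal_equation hP (h.u_step (k + 1))]
      change act Pᴴ (v₁ (k + 1) + v₁ (k + 1) - (v₁ (k + 1) - d₁ (k + 1)) - act P (u (k + 2))) +
        act Bᴴ (v₂ (k + 1) + v₂ (k + 1) - (v₂ (k + 1) - d₂ (k + 1)) - act B (u (k + 2))) = _
      congr 2 <;> abel
  refine ⟨x', ?_, ?_⟩
  · rw [mem_orthogonal_range_stacked] at hT
    have e₁ : act P x' = J₁ T.fst := congrArg WithLp.fst hx'
    have e₂ : act B x' = J₂ T.snd := congrArg WithLp.snd hx'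
    have hs : act Pᴴ (T.fst - J₁ T.fst) + act Bᴴ (T.snd - J₂ T.snd) = 0 := by
      have hT' : act Pᴴ (J₁ T.fst - T.fst) + act Bᴴ (J₂ T.snd - T.snd) = 0 := hT
      rw [act_sub, act_sub] at hT' ⊢
      rw [← neg_eq_zero, ← hT']
      abel
    refine IsKuhnTuckerPair.isSolution (lam₁ := (((1 / μ)⁻¹ : ℝ) : 𝕜) • (T.fst - J₁ T.fst))
      (lam₂ := (((1 / μ)⁻¹ : ℝ) : 𝕜) • (T.snd - J₂ T.snd)) ⟨?_, ?_, ?_⟩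
    · rw [e₁]
      exact (hJ₁ T.fst).isSubgradient hφ.proper hφ.convex hτ
    · rw [e₂]
      exact (hJ₂ T.snd).isSubgradient hι.proper hι.convex hτ
    · rw [act_smul, act_smul, ← smul_add, hs, smul_zero]
  · rw [← hx'] at hlim
    have hc : Continuous fun w : WithLp 2 (EuclideanSpace 𝕜 (Fin p) × EuclideanSpace 𝕜 (Fin m)) ↦
        act Pᴴ w.fst := (continuous_act _).comp (WithLp.prod_continuous_ofLp 2 _ _).fst
    have h1 := (hc.tendsto _).comp hlim
    have e : ∀ x, act Pᴴ (stacked P B x).fst = x := fun x ↦ by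
      change act Pᴴ (act P x) = x
      rw [act_act, hP, act_one]
    simp only [Function.comp_def, e] at h1
    exact (tendsto_add_atTop_iff_nat 2).1 h1

end Convergence

end CSalsa

theorem mainTheorem2 {𝕜 : Type*} [RCLike 𝕜] {n p m : ℕ}
    (φ : EuclideanSpace 𝕜 (Fin p) → EReal)
    (P : Matrix (Fin p) (Fin n) 𝕜) (B : Matrix (Fin m) (Fin n) 𝕜)
    (y : EuclideanSpace 𝕜 (Fin m)) (ε : ℝ)
    (hφ : CSalsa.IsClosedProperConvex φ)
    (hP : Pᴴ * P = 1)
    (hsol : ∃ x, CSalsa.IsSolution φ P B y ε x ∧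
      ∃ lam₁ lam₂, CSalsa.IsKuhnTuckerPair φ P B y ε x lam₁ lam₂) :
    (Matrix.fromRows P B).rank = n ∧
    ∀ μ : ℝ, 0 < μ →
      (∀ (a₁ b₁ : EuclideanSpace 𝕜 (Fin p)) (a₂ b₂ : EuclideanSpace 𝕜 (Fin m)),
        ∃ u v₁ v₂ d₁ d₂, CSalsa.IsCSalsa2 φ P B y ε μ u v₁ v₂ d₁ d₂ ∧
          v₁ 0 = a₁ ∧ v₂ 0 = a₂ ∧ d₁ 0 = b₁ ∧ d₂ 0 = b₂) ∧
      ∀ u v₁ v₂ d₁ d₂, CSalsa.IsCSalsa2 φ P B y ε μ u v₁ v₂ d₁ d₂ →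
        ∃ x, CSalsa.IsSolution φ P B y ε x ∧ Tendsto u atTop (𝓝 x) := by
  obtain ⟨x, -, lam₁, lam₂, hx⟩ := hsol
  refine ⟨CSalsa.rank_fromRows_of_conjTranspose_mul_self hP, fun μ hμ ↦ ⟨?_, ?_⟩⟩
  · have hι : CSalsa.IsClosedProperConvex (CSalsa.indicatorFn (Metric.closedBall y ε)) :=
      CSalsa.isClosedProperConvex_indicatorFn Metric.isClosed_closedBall (convex_closedBall y ε)
        ⟨_, CSalsa.mem_of_indicatorFn_ne_top hx.subgradient₂.1⟩
    exact CSalsa.exists_isCSalsa2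
      (hx.subgradient₁.exists_isMoreauProx hφ.closed hφ.proper (by positivity))
      fun s ↦ by
        exact_mod_cast hx.subgradient₂.exists_isMoreauProx hι.closed hι.proper one_pos s
  · exact fun u v₁ v₂ d₁ d₂ h ↦ h.exists_tendsto_isSolution hφ hP hμ hx
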